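/- **Setting.** Let $N\ge 1$ and $b\in\mathbb R$ with $b\neq 0$. Let $m_0,\dots,m_{N-1}$ be i.i.d. real random variables with an arbitrary common law, and let the message space $\mathbb X$ be a standard Borel space. In the $N$-stage repeated scalar cheap talk game the encoder sends at stage $k$ the message $x_k=\gamma^e_k(m_{[0,k]},x_{[0,k-1]})\in\mathbb X$, and the decoder takes the action $u_k=\gamma^d_k(x_{[0,k]})\in\mathbb R$. All policies are deterministic and Borel measurable. The stage costs are $(m_k-u_k-b)^2$ for the encoder and $(m_k-u_k)^2$ for the decoder, and expected costs may be $+\infty$. **Equilibrium of the final stage.** Fix arbitrary policies $(\gamma^e_{[0,N-2]},\gamma^d_{[0,N-2]})$ of the earlier stages. The pair $(\gamma^e_{N-1},\gamma^d_{N-1})$ is a *perfect Bayesian equilibrium of the final stage* if for every measurable event $E$ that is determined by the encoder's information $(m_{[0,N-1]},x_{[0,N-2]})$, no other measurable policy of the encoder for the final stage gives a smaller value of $\mathbb E[(m_{N-1}-u_{N-1}-b)^2\mathbf 1_E]$, and for every measurable event $D$ that is determined by the decoder's information $x_{[0,N-1]}$, no other measurable policy of the decoder for the final stage gives a smaller value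 of $\mathbb E[(m_{N-1}-u_{N-1})^2\mathbf 1_D]$ (here $E$ and $D$ are determined by the information generated by the given policies, and stay fixed under the deviation). It is a *Nash equilibrium of the final stage* if these two conditions hold with $E$ and $D$ the sure event. **Theorem.** Suppose that $(\gamma^e_{N-1},\gamma^d_{N-1})$ is a perfect Bayesian equilibrium of the final stage, or that it is a Nash equilibrium of the final stage at which the encoder's expected final-stage cost is finite. Then the encoder policy of the final stage is quantized, in the following sense. There is a jointly measurable map $(h,m)\mapsto q_h(m)$ from $\mathbb X^{N-1}\times\mathbb R$ to $\mathbb X$ such that for every $h$ the map $q_h$ has countable range and all its bins $q_h^{-1}(\{x\})$, $x\in\mathbb X$, are convex, and such that the encoder policy $x_{N-1}=q_{x_{[0,N-2]}}(m_{N-1})$, which uses only the common information and the current source value, satisfies the following, where $h=x_{[0,N-2]}$, $u_{N-1}$ denotes the action under $\gamma^e_{N-1}$, and $u'_{N-1}$ the action under the policy $q$, both with the same decoder policy and the same earlier policies: 1. almost surely $(m_{N-1}-u'_{N-1}-b)^2=(m_{N-1}-u_{N-1}-b)^2$; in particular the performance of the equilibrium encoder policy equals that of the quantized policy; 2. almost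 surely $u_{N-1}$ is one of the countably many values $\gamma^d_{N-1}(h,q_h(t))$, $t\in\mathbb R$; 3. almost surely $u_{N-1}=u'_{N-1}$ or $m_{N-1}$ is a boundary point of its bin $q_h^{-1}(\{q_h(m_{N-1})\})$; 4. if the law of $m_{N-1}$ has no atoms, then $u_{N-1}=u'_{N-1}$ almost surely, and the policy $q$ together with $\gamma^d_{N-1}$ is a perfect Bayesian equilibrium of the final stage. -/

import Mathlib

open MeasureTheory ProbabilityTheory Set

namespace CheapTalk

/-- The information `(m_{[0,k]}, x_{[0,k-1]})` of the encoder at stage `k`. -/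
abbrev EncInfo (X : Type*) (k : ℕ) : Type _ := (Fin (k + 1) → ℝ) × (Fin k → X)

/-- The information `x_{[0,k]}` of the decoder at stage `k`. -/
abbrev DecInfo (X : Type*) (k : ℕ) : Type _ := Fin (k + 1) → X

/-- A sequence of (deterministic) encoder policies, one for each stage.  In an `N`-stage game only
the entries with index `k < N` are used. -/
abbrev EncPolicy (X : Type*) : Type _ := ∀ k : ℕ, EncInfo X k → X

/-- A sequence of (deterministic) decoder policies, one for each stage. -/
abbrev DecPolicy (X : Type*) : Type _ := ∀ k : ℕ, DecInfo X k → ℝ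

variable {X : Type*}

/-- The messages `x_{[0,k-1]}` sent before stage `k` when the source takes the values `m`. -/
def history (γe : EncPolicy X) (m : ℕ → ℝ) : ∀ k : ℕ, Fin k → X
  | 0 => Fin.elim0
  | k + 1 => Fin.snoc (α := fun _ => X) (history γe m k)
      (γe k (fun i => m i, history γe m k))

/-- The realized information of the encoder at stage `k`. -/
def encInfo (γe : EncPolicy X) (m : ℕ → ℝ) (k : ℕ) : EncInfo X k :=
  (fun i => m i, history γe m k)

/-- The realized information of the decoder at stage `k`. -/
def decInfo (γe : EncPolicy X) (m : ℕ → ℝ) (k : ℕ) : DecInfo X k :=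
  history γe m (k + 1)

/-- The action `u_k` of the decoder at stage `k`. -/
def action (γe : EncPolicy X) (γd : DecPolicy X) (m : ℕ → ℝ) (k : ℕ) : ℝ :=
  γd k (decInfo γe m k)

/-- The encoder's cost `(m_k - u_k - b)²` at stage `k`, as an extended nonnegative real. -/
noncomputable def encCost (b : ℝ) (γe : EncPolicy X) (γd : DecPolicy X) (m : ℕ → ℝ) (k : ℕ) :
    ENNReal :=
  ENNReal.ofReal ((m k - action γe γd m k - b) ^ 2)

/-- The decoder's cost `(m_k - u_k)²` at stage `k`. -/
noncomputable def decCost (γe : EncPolicy X) (γd : DecPolicy X) (m : ℕ → ℝ) (k : ℕ) : ENNReal :=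
  ENNReal.ofReal ((m k - action γe γd m k) ^ 2)

section Equilibrium

variable {Ω : Type*} [MeasurableSpace Ω] [MeasurableSpace X]

/-- Given the policies of all earlier stages, the policies `γe n`, `γd n` of stage `n` form a Nash
equilibrium for the expected costs of stage `n`: no player gains by replacing the own policy of
stage `n` with another Borel measurable one. -/
def IsStageNash (P : Measure Ω) (M : ℕ → Ω → ℝ) (b : ℝ) (n : ℕ)
    (γe : EncPolicy X) (γd : DecPolicy X) : Prop :=
  (∀ g : EncInfo X n → X, Measurable g →
    ∫⁻ ω, encCost b γe γd (fun k => M k ω) n ∂P ≤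
      ∫⁻ ω, encCost b (Function.update γe n g) γd (fun k => M k ω) n ∂P) ∧
  (∀ d : DecInfo X n → ℝ, Measurable d →
    ∫⁻ ω, decCost γe γd (fun k => M k ω) n ∂P ≤
      ∫⁻ ω, decCost γe (Function.update γd n d) (fun k => M k ω) n ∂P)

/-- The perfect Bayesian form of the stage-`n` equilibrium: given the policies of all earlier
stages, each player acts optimally for (almost) every realized value of the own information.
This is expressed without conditional distributions: no player can lower the expected cost of
stage `n` on an event that is observable to that player. -/
def IsStagePerfectBayesian (P : Measure Ω) (M : ℕ → Ω → ℝ) (b : ℝ) (n : ℕ)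
    (γe : EncPolicy X) (γd : DecPolicy X) : Prop :=
  (∀ g : EncInfo X n → X, Measurable g → ∀ E : Set (EncInfo X n), MeasurableSet E →
    ∫⁻ ω in {ω | encInfo γe (fun k => M k ω) n ∈ E}, encCost b γe γd (fun k => M k ω) n ∂P ≤
      ∫⁻ ω in {ω | encInfo γe (fun k => M k ω) n ∈ E},
        encCost b (Function.update γe n g) γd (fun k => M k ω) n ∂P) ∧
  (∀ d : DecInfo X n → ℝ, Measurable d → ∀ D : Set (DecInfo X n), MeasurableSet D →
    ∫⁻ ω in {ω | decInfo γe (fun k => M k ω) n ∈ D}, decCost γe γd (fun k => M k ω) n ∂P ≤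
      ∫⁻ ω in {ω | decInfo γe (fun k => M k ω) n ∈ D},
        decCost γe (Function.update γd n d) (fun k => M k ω) n ∂P)

end Equilibrium

/-- A quantizer: countably many messages, and every bin `{m | f m = x}` is convex. -/
def IsQuantizer (f : ℝ → X) : Prop :=
  (range f).Countable ∧ ∀ x : X, Convex ℝ (f ⁻¹' {x})

/-- The stage-`n` encoder policy that sends `q x_{[0,n-1]} m_n`: of the source values it uses only
the current one, and otherwise only the common information. -/
def currentPolicy {n : ℕ} (q : (Fin n → X) → ℝ → X) : EncInfo X n → X :=
  fun i => q i.2 (i.1 (Fin.last n))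

end CheapTalk

/-! Fix the common information `h`, put `δ = |b| / 3`, and consider the law of the action given `h`.
If actions in use approach `u` within `δ` from both sides with positive mass, then a source value at
which the encoder prefers `u` to them lies within `δ` of `u + b`. On the event of such messages the
decoder could cut the error from at least `2δ` to at most `δ` by answering `u + b`, so this event is
null (`ae_not_two_sided`). An action law that is one-sided in this sense is purely atomic, and any
three distinct atoms span at least `δ` (`OneSided.ae_atom`, `OneSided.ae_sample`); hence the actions
in use are locally finite.

The messages inducing them must depend measurably on `h`. The conditional law of the message is the
image of a uniform seed, and an i.i.d. sequence of seeds almost surely finds every atom. By Fubini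
one fixed sequence of seeds serves almost every `h` (`exists_messages`).

The quantizer sends the message of least index whose action is preferred. Preferences among fixed
actions are decided by their midpoints shifted by `b`, so the bins are intervals, and the
equilibrium action can differ from the quantized one only at a tie, that is, on the boundary of a
bin. An atomless source value, being independent of `h`, almost surely avoids the countably many
ties. Decoder optimality then transfers because the new message is a function of `h` and the action.
-/

namespace CheapTalk

open unitInterval

/-- If every point `u` of a set comes with an open null set `J u` such that of any two points
closer than `δ` one lies in the set of the other, then almost every such point is an atom. -/
lemma ae_atom_of_null_neighbors (ν : Measure ℝ) {δ : ℝ} (hδ : 0 < δ) (J : ℝ → Set ℝ)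
    (hJ : ∀ u, IsOpen (J u)) (hnear : ∀ u v, u < v → v < u + δ → u ∈ J v ∨ v ∈ J u) :
    ∀ᵐ u ∂ν, ν (J u) = 0 → ν {u} ≠ 0 := by
  set B : Set ℝ := {u | ν (J u) = 0} with hB
  -- Lindelöf: countably many of the null open sets have the same union, which is therefore null.
  obtain ⟨T, hTB, hTc, hTU⟩ := TopologicalSpace.isOpen_biUnion_countable B J (fun u _ => hJ u)
  have hV : ν (⋃ u ∈ B, J u) = 0 := by
    rw [← hTU]
    exact (measure_biUnion_null_iff hTc).2 fun u hu => hTB hu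
  -- `J u` need not contain `u`, so points of `B` may escape the union. Those that do are
  -- `δ`-separated, hence countable, and the ones that are not atoms form a null set.
  set C : Set ℝ := {u | u ∈ B ∧ ν {u} = 0 ∧ u ∉ ⋃ v ∈ B, J v} with hC
  have hsep : ∀ u ∈ C, ∀ v ∈ C, u < v → u + δ ≤ v := by
    intro u hu v hv huv
    by_contra! hlt
    rcases hnear u v huv hlt with h | h
    · exact hu.2.2 (mem_biUnion hv.1 h)
    · exact hv.2.2 (mem_biUnion hu.1 h)
  have hCc : C.Countable := by
    apply Set.PairwiseDisjoint.countable_of_Ioo (y := fun u => u + δ) _ (fun u _ => by linarith)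
    intro u hu v hv huv
    rw [Function.onFun, Set.disjoint_left]
    intro x hx hx'
    rcases lt_or_gt_of_ne huv with h | h
    · linarith [hsep u hu v hv h, hx.2, hx'.1]
    · linarith [hsep v hv u hu h, hx.1, hx'.2]
  have hC0 : ν C = 0 := by
    rw [← biUnion_of_singleton C]
    exact (measure_biUnion_null_iff hCc).2 fun u hu => hu.2.1
  have h1 := measure_eq_zero_iff_ae_notMem.1 hV
  have h2 := measure_eq_zero_iff_ae_notMem.1 hC0
  filter_upwards [h1, h2] with u hu1 hu2 hJu h0
  exact hu2 ⟨hJu, h0, hu1⟩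

/-! ### One-sided random variables and i.i.d. sampling of their atoms -/

section Sampling

variable {T : Type*} [MeasurableSpace T] (μ : Measure T)

/-- Almost every value of `a` fails to be approached in mass, within distance `δ`, from both
sides. -/
def OneSided (a : T → ℝ) (δ : ℝ) : Prop :=
  ∀ᵐ t ∂μ, μ {t' | a t' ∈ Ioo (a t - δ) (a t)} = 0 ∨ μ {t' | a t' ∈ Ioo (a t) (a t + δ)} = 0

variable {μ}

/-- The left and the right intervals each satisfy the hypotheses of `ae_atom_of_null_neighbors`, and
at almost every value one of the two is null. -/
lemma OneSided.ae_atom {a : T → ℝ} (ha : Measurable a) {δ : ℝ} (hδ : 0 < δ)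
    (h : OneSided μ a δ) : ∀ᵐ t ∂μ, μ {t' | a t' = a t} ≠ 0 := by
  have h1 := ae_of_ae_map ha.aemeasurable
    (ae_atom_of_null_neighbors (μ.map a) hδ (fun u => Ioo (u - δ) u) (fun u => isOpen_Ioo)
      (fun u v huv hv => Or.inl ⟨by linarith, huv⟩))
  have h2 := ae_of_ae_map ha.aemeasurable
    (ae_atom_of_null_neighbors (μ.map a) hδ (fun u => Ioo u (u + δ)) (fun u => isOpen_Ioo)
      (fun u v huv hv => Or.inr ⟨huv, hv⟩))
  filter_upwards [h, h1, h2] with t ht ht1 ht2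
  rw [Measure.map_apply ha measurableSet_Ioo, Measure.map_apply ha (measurableSet_singleton _)]
    at ht1 ht2
  exact ht.elim ht1 ht2

variable [IsProbabilityMeasure μ]

/-- An independent sample hits every event of positive probability. -/
lemma ae_exists_sample_mem {A : Set T} (hA : MeasurableSet A) (h0 : μ A ≠ 0) :
    ∀ᵐ s ∂(Measure.infinitePi fun _ : ℕ => μ), ∃ k, s k ∈ A := by
  rw [ae_iff]
  have hc : μ Aᶜ < 1 := by
    rw [prob_compl_eq_one_sub hA]
    exact ENNReal.sub_lt_self ENNReal.one_ne_top one_ne_zero h0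
  have hle : ∀ N : ℕ, Measure.infinitePi (fun _ : ℕ => μ) {s | ¬ ∃ k, s k ∈ A} ≤ μ Aᶜ ^ N := by
    intro N
    have := Measure.infinitePi_pi (fun _ : ℕ => μ) (s := Finset.range N) (t := fun _ => Aᶜ)
      (fun _ _ => hA.compl)
    rw [Finset.prod_const, Finset.card_range] at this
    rw [← this]
    refine measure_mono fun s hs => ?_
    intro k _ hk
    exact hs ⟨k, hk⟩
  exact le_antisymm (ge_of_tendsto' (ENNReal.tendsto_pow_atTop_nhds_zero_of_lt_one hc) hle)
    zero_le

/-- An independent sample of a one-sided random variable contains almost all of its values, and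
of any three distinct sampled values the extreme ones have distance at least `δ`. -/
lemma OneSided.ae_sample {a : T → ℝ} (ha : Measurable a) {δ : ℝ} (hδ : 0 < δ)
    (h : OneSided μ a δ) :
    ∀ᵐ s ∂(Measure.infinitePi fun _ : ℕ => μ), (∀ᵐ t ∂μ, ∃ k, a t = a (s k)) ∧
      ∀ i j k, a (s i) < a (s j) → a (s j) < a (s k) → δ ≤ a (s k) - a (s i) := by
  have hat := h.ae_atom ha hδ
  have h1 : ∀ᵐ s ∂(Measure.infinitePi fun _ : ℕ => μ), ∀ᵐ t ∂μ, ∃ k, a t = a (s k) := by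
    have hm : MeasurableSet {x : T × (ℕ → T) | ∃ k, a x.1 = a (x.2 k)} := by
      have : {x : T × (ℕ → T) | ∃ k, a x.1 = a (x.2 k)} =
          ⋃ k, {x : T × (ℕ → T) | a x.1 = a (x.2 k)} := by ext; simp
      rw [this]
      exact MeasurableSet.iUnion fun k => measurableSet_eq_fun (by fun_prop) (by fun_prop)
    -- By Fubini it suffices to fix `t`: its value is an atom, so the sample hits it almost surely.
    rw [← Measure.ae_ae_comm (p := fun t (s : ℕ → T) => ∃ k, a t = a (s k)) hm]
    filter_upwards [hat] with t ht
    have := ae_exists_sample_mem (μ := μ) (ha (measurableSet_singleton (a t))) ht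
    filter_upwards [this] with s hs
    obtain ⟨k, hk⟩ := hs
    exact ⟨k, Eq.symm hk⟩
  have h2 : ∀ᵐ s ∂(Measure.infinitePi fun _ : ℕ => μ), ∀ k, μ {t' | a t' = a (s k)} ≠ 0 ∧
      (μ {t' | a t' ∈ Ioo (a (s k) - δ) (a (s k))} = 0 ∨
        μ {t' | a t' ∈ Ioo (a (s k)) (a (s k) + δ)} = 0) := by
    rw [ae_all_iff]
    intro k
    exact (measurePreserving_eval_infinitePi (fun _ : ℕ => μ) k).quasiMeasurePreserving.ae
      (hat.and h)
  filter_upwards [h1, h2] with s hs1 hs2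
  refine ⟨hs1, fun i j k hij hjk => ?_⟩
  by_contra! hlt
  -- If the extremes were closer than `δ`, the one on the null side of the middle value would be an
  -- atom inside a null interval.
  rcases (hs2 j).2 with h0 | h0
  · refine (hs2 i).1 (measure_mono_null ?_ h0)
    intro t ht
    have ht : a t = a (s i) := ht
    exact ⟨by linarith, by linarith⟩
  · refine (hs2 k).1 (measure_mono_null ?_ h0)
    intro t ht
    have ht : a t = a (s k) := ht
    exact ⟨by linarith, by linarith⟩

end Sampling

/-! ### Separation of the equilibrium actions and measurable choice of messages -/

section Core

variable {Ω : Type*} [MeasurableSpace Ω] {P : Measure Ω} [IsProbabilityMeasure P]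
  {𝓗 : Type*} [MeasurableSpace 𝓗] {X : Type*} [MeasurableSpace X]

/-- The conditional law of a random variable can be sampled from a uniform variable. -/
lemma exists_conditional_sampler [StandardBorelSpace X] {H : Ω → 𝓗} (hH : Measurable H)
    {Y : Ω → X} (hY : Measurable Y) :
    ∃ f : 𝓗 → I → X, Measurable (Function.uncurry f) ∧ ∀ p : 𝓗 × X → Prop,
      MeasurableSet {z | p z} →
        ((∀ᵐ ω ∂P, p (H ω, Y ω)) ↔ ∀ᵐ ω ∂P, ∀ᵐ t : I, p (H ω, f (H ω) t)) := by
  have : Nonempty Ω := nonempty_of_isProbabilityMeasure P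
  have : Nonempty X := this.map Y
  obtain ⟨f, hf, hfκ⟩ := Kernel.exists_measurable_map_eq_unitInterval (condDistrib Y H P)
  refine ⟨f, hf, fun p hp => ?_⟩
  have hfh : ∀ h, Measurable (f h) := fun h => hf.of_uncurry_left
  have hpm : MeasurableSet {h : 𝓗 | ∀ᵐ t : I, p (h, f h t)} := by
    have hs : MeasurableSet {z : 𝓗 × I | p (z.1, f z.1 z.2)}ᶜ :=
      (hp.preimage (measurable_fst.prodMk hf)).compl
    exact (measurable_measure_prodMk_left (ν := (volume : Measure I)) hs)
      (measurableSet_singleton 0)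
  -- The joint law disintegrates into the law of `H` and the conditional law of `Y`, which is the
  -- image of Lebesgue measure under `f h`.
  have h1 : (∀ᵐ ω ∂P, p (H ω, Y ω)) ↔ ∀ᵐ z ∂(P.map fun ω => (H ω, Y ω)), p z :=
    (ae_map_iff (hH.prodMk hY).aemeasurable hp).symm
  rw [h1, ← compProd_map_condDistrib hY.aemeasurable, Measure.ae_compProd_iff hp,
    ← ae_map_iff hH.aemeasurable (p := fun h => ∀ᵐ t : I, p (h, f h t)) hpm]
  refine Filter.eventually_congr (Filter.Eventually.of_forall fun h => ?_)
  rw [← hfκ h, ae_map_iff (hfh h).aemeasurable]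
  exact hp.preimage measurable_prodMk_left

variable {H : Ω → 𝓗} {Y : Ω → X} {M : Ω → ℝ} {γ : 𝓗 → X → ℝ} {b : ℝ}

lemma measurableSet_two_sided {a : 𝓗 → I → ℝ} (ha : Measurable (Function.uncurry a))
    (hγ : Measurable (Function.uncurry γ)) (δ : ℝ) :
    MeasurableSet {z : 𝓗 × X |
      volume {t : I | a z.1 t ∈ Ioo (γ z.1 z.2 - δ) (γ z.1 z.2)} = 0 ∨
      volume {t : I | a z.1 t ∈ Ioo (γ z.1 z.2) (γ z.1 z.2 + δ)} = 0} := by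
  have ha' : Measurable fun w : (𝓗 × X) × I => a w.1.1 w.2 :=
    ha.comp (measurable_fst.fst.prodMk measurable_snd)
  have hγ' : Measurable fun w : (𝓗 × X) × I => γ w.1.1 w.1.2 :=
    hγ.comp (measurable_fst.fst.prodMk measurable_fst.snd)
  refine MeasurableSet.union ?_ ?_
  · have hs : MeasurableSet {w : (𝓗 × X) × I |
        a w.1.1 w.2 ∈ Ioo (γ w.1.1 w.1.2 - δ) (γ w.1.1 w.1.2)} :=
      (measurableSet_lt (hγ'.sub_const δ) ha').inter (measurableSet_lt ha' hγ')
    exact (measurable_measure_prodMk_left (ν := (volume : Measure I)) hs)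
      (measurableSet_singleton 0)
  · have hs : MeasurableSet {w : (𝓗 × X) × I |
        a w.1.1 w.2 ∈ Ioo (γ w.1.1 w.1.2) (γ w.1.1 w.1.2 + δ)} :=
      (measurableSet_lt hγ' ha').inter (measurableSet_lt ha' (hγ'.add_const δ))
    exact (measurable_measure_prodMk_left (ν := (volume : Measure I)) hs)
      (measurableSet_singleton 0)

/-- When the encoder prefers the action `u` to nearby actions on both sides, the source is close
to `u + b`. -/
lemma abs_sub_le_of_preferred {m u v w b δ : ℝ} (hv : v ∈ Ioo (u - δ) u) (hw : w ∈ Ioo u (u + δ))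
    (hmv : |m - u - b| ≤ |m - v - b|) (hmw : |m - u - b| ≤ |m - w - b|) : |m - u - b| ≤ δ := by
  obtain ⟨hv1, hv2⟩ := hv
  obtain ⟨hw1, hw2⟩ := hw
  rw [← sq_le_sq] at hmv hmw
  rw [abs_le]
  constructor <;> nlinarith

/-- Since the decoder's action is optimal while the encoder is biased, the actions used given the
common information are almost surely not approached from both sides by actions in use. -/
lemma ae_not_two_sided (hb : b ≠ 0) (hH : Measurable H) (hY : Measurable Y)
    (hγ : Measurable (Function.uncurry γ))
    (hdec : ∀ d : 𝓗 × X → ℝ, Measurable d → ∀ D : Set (𝓗 × X), MeasurableSet D →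
      ∫⁻ ω in {ω | (H ω, Y ω) ∈ D}, ENNReal.ofReal ((M ω - γ (H ω) (Y ω)) ^ 2) ∂P ≤
        ∫⁻ ω in {ω | (H ω, Y ω) ∈ D}, ENNReal.ofReal ((M ω - d (H ω, Y ω)) ^ 2) ∂P)
    {a : 𝓗 → I → ℝ} (ha : Measurable (Function.uncurry a))
    (henc : ∀ᵐ ω ∂P, ∀ᵐ t : I, |M ω - γ (H ω) (Y ω) - b| ≤ |M ω - a (H ω) t - b|) :
    ∀ᵐ ω ∂P,
      volume {t : I | a (H ω) t ∈ Ioo (γ (H ω) (Y ω) - |b| / 3) (γ (H ω) (Y ω))} = 0 ∨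
      volume {t : I | a (H ω) t ∈ Ioo (γ (H ω) (Y ω)) (γ (H ω) (Y ω) + |b| / 3)} = 0 := by
  -- With this `δ`, the error `|b| - δ = 2δ` guaranteed for `γ` exceeds the bound `δ` for `γ + b`.
  set δ := |b| / 3 with hδ
  have hb' : |b| = 3 * δ := by rw [hδ]; ring
  have hδ0 : 0 < δ := by have := abs_pos.2 hb; positivity
  set G : Set (𝓗 × X) := {z |
      volume {t : I | a z.1 t ∈ Ioo (γ z.1 z.2 - δ) (γ z.1 z.2)} = 0 ∨
      volume {t : I | a z.1 t ∈ Ioo (γ z.1 z.2) (γ z.1 z.2 + δ)} = 0} with hG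
  have hGm : MeasurableSet G := measurableSet_two_sided ha hγ δ
  set S : Set Ω := {ω | (H ω, Y ω) ∈ Gᶜ} with hS
  have hSm : MeasurableSet S := hGm.compl.preimage (hH.prodMk hY)
  have hclose : ∀ᵐ ω ∂P, ω ∈ S → |M ω - γ (H ω) (Y ω) - b| ≤ δ := by
    filter_upwards [henc] with ω hω hωS
    have hωS : ¬ (_ ∨ _) := hωS
    rw [not_or] at hωS
    -- A set of seeds of positive measure contains one at which the almost sure preference holds.
    obtain ⟨v, hv, hv'⟩ := (Filter.Frequently.and_eventually
      (frequently_ae_mem_iff.2 hωS.1) hω).exists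
    obtain ⟨w, hw, hw'⟩ := (Filter.Frequently.and_eventually
      (frequently_ae_mem_iff.2 hωS.2) hω).exists
    exact abs_sub_le_of_preferred hv hw hv' hw'
  -- The decoder deviates by adding the bias, on the observable event that the action is two-sided.
  have hmain := hdec (fun z => γ z.1 z.2 + b) (by exact hγ.add_const b) Gᶜ hGm.compl
  have hlow : ENNReal.ofReal ((2 * δ) ^ 2) * P S ≤
      ∫⁻ ω in S, ENNReal.ofReal ((M ω - γ (H ω) (Y ω)) ^ 2) ∂P := by
    rw [← setLIntegral_const]
    refine lintegral_mono_ae ((ae_restrict_iff' hSm).2 ?_)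
    filter_upwards [hclose] with ω hω hωS
    refine ENNReal.ofReal_le_ofReal (sq_le_sq.2 ?_)
    rw [abs_of_pos (by positivity)]
    have h1 := abs_sub_abs_le_abs_sub b (-(M ω - γ (H ω) (Y ω) - b))
    rw [abs_neg] at h1
    have h2 : b - -(M ω - γ (H ω) (Y ω) - b) = M ω - γ (H ω) (Y ω) := by ring
    rw [h2] at h1
    linarith [hω hωS]
  have hup : ∫⁻ ω in S, ENNReal.ofReal ((M ω - (γ (H ω) (Y ω) + b)) ^ 2) ∂P ≤
      ENNReal.ofReal (δ ^ 2) * P S := by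
    rw [← setLIntegral_const]
    refine lintegral_mono_ae ((ae_restrict_iff' hSm).2 ?_)
    filter_upwards [hclose] with ω hω hωS
    refine ENNReal.ofReal_le_ofReal (sq_le_sq.2 ?_)
    rw [abs_of_pos hδ0, ← sub_sub]
    exact hω hωS
  have hle := hlow.trans (hmain.trans hup)
  have hS0 : P S = 0 := by
    by_contra h0
    rw [ENNReal.mul_le_mul_iff_left h0 (measure_ne_top P S),
      ENNReal.ofReal_le_ofReal_iff (by positivity)] at hle
    nlinarith
  filter_upwards [measure_eq_zero_iff_ae_notMem.1 hS0] with ω hω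
  exact not_not.1 hω

/-- At an equilibrium, countably many messages, which depend measurably on the common
information, induce all actions in use, and these actions are separated. -/
theorem exists_messages [StandardBorelSpace X] (hb : b ≠ 0)
    (hH : Measurable H) (hY : Measurable Y) (hM : Measurable M)
    (hγ : Measurable (Function.uncurry γ))
    (henc : ∀ g : 𝓗 → X, Measurable g →
      ∀ᵐ ω ∂P, |M ω - γ (H ω) (Y ω) - b| ≤ |M ω - γ (H ω) (g (H ω)) - b|)
    (hdec : ∀ d : 𝓗 × X → ℝ, Measurable d → ∀ D : Set (𝓗 × X), MeasurableSet D →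
      ∫⁻ ω in {ω | (H ω, Y ω) ∈ D}, ENNReal.ofReal ((M ω - γ (H ω) (Y ω)) ^ 2) ∂P ≤
        ∫⁻ ω in {ω | (H ω, Y ω) ∈ D}, ENNReal.ofReal ((M ω - d (H ω, Y ω)) ^ 2) ∂P) :
    ∃ φ : ℕ → 𝓗 → X, (∀ k, Measurable (φ k)) ∧
      (∀ᵐ ω ∂P, ∃ k, γ (H ω) (Y ω) = γ (H ω) (φ k (H ω))) ∧
      ∀ᵐ ω ∂P, ∀ i j k, γ (H ω) (φ i (H ω)) < γ (H ω) (φ j (H ω)) →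
        γ (H ω) (φ j (H ω)) < γ (H ω) (φ k (H ω)) →
        |b| / 3 ≤ γ (H ω) (φ k (H ω)) - γ (H ω) (φ i (H ω)) := by
  obtain ⟨f, hf, hfT⟩ := exists_conditional_sampler (P := P) hH hY
  set a : 𝓗 → I → ℝ := fun h t => γ h (f h t) with ha_def
  have ha : Measurable (Function.uncurry a) := hγ.comp (measurable_fst.prodMk hf)
  have hδ0 : 0 < |b| / 3 := by have := abs_pos.2 hb; positivity
  have hfk : ∀ t, Measurable fun h => f h t := fun t => hf.of_uncurry_right
  have henc' : ∀ᵐ ω ∂P, ∀ᵐ t : I, |M ω - γ (H ω) (Y ω) - b| ≤ |M ω - a (H ω) t - b| := by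
    -- For a fixed seed `t`, the map `h ↦ f h t` is an admissible deviation; Fubini moves the
    -- quantifier over `t` inside.
    rw [Measure.ae_ae_comm]
    · exact Filter.Eventually.of_forall fun t => henc (fun h => f h t) (hfk t)
    · have h1 : Measurable fun z : Ω × I => M z.1 - γ (H z.1) (Y z.1) - b :=
        ((hM.comp measurable_fst).sub
          (hγ.comp ((hH.comp measurable_fst).prodMk (hY.comp measurable_fst)))).sub_const b
      have h2 : Measurable fun z : Ω × I => M z.1 - a (H z.1) z.2 - b :=
        ((hM.comp measurable_fst).sub
          (ha.comp ((hH.comp measurable_fst).prodMk measurable_snd))).sub_const b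
      exact measurableSet_le (continuous_abs.measurable.comp h1) (continuous_abs.measurable.comp h2)
  have hone : ∀ᵐ ω ∂P, OneSided volume (a (H ω)) (|b| / 3) :=
    (hfT _ (measurableSet_two_sided ha hγ (|b| / 3))).1
      (ae_not_two_sided hb hH hY hγ hdec ha henc')
  have hsample : ∀ᵐ ω ∂P, ∀ᵐ s ∂(Measure.infinitePi fun _ : ℕ => (volume : Measure I)),
      (∀ᵐ t : I, ∃ k, a (H ω) t = a (H ω) (s k)) ∧
      ∀ i j k, a (H ω) (s i) < a (H ω) (s j) → a (H ω) (s j) < a (H ω) (s k) →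
        |b| / 3 ≤ a (H ω) (s k) - a (H ω) (s i) := by
    filter_upwards [hone] with ω hω
    exact hω.ae_sample ha.of_uncurry_left hδ0
  -- After the exchange, a single seed sequence `s` works for almost every `ω`; this replaces a
  -- measurable selection of atoms.
  rw [Measure.ae_ae_comm] at hsample
  · obtain ⟨s, hs⟩ := hsample.exists
    refine ⟨fun k h => f h (s k), fun k => hfk (s k), ?_, ?_⟩
    · refine (hfT (fun z => ∃ k, γ z.1 z.2 = γ z.1 (f z.1 (s k))) ?_).2 ?_
      · have : {z : 𝓗 × X | ∃ k, γ z.1 z.2 = γ z.1 (f z.1 (s k))} =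
            ⋃ k, {z : 𝓗 × X | γ z.1 z.2 = γ z.1 (f z.1 (s k))} := by ext; simp
        rw [this]
        exact MeasurableSet.iUnion fun k => measurableSet_eq_fun hγ
          (hγ.comp (measurable_fst.prodMk ((hfk (s k)).comp measurable_fst)))
      · filter_upwards [hs] with ω hω using hω.1
    · filter_upwards [hs] with ω hω using hω.2
  · have hm : ∀ k : ℕ, Measurable fun z : Ω × (ℕ → I) => a (H z.1) (z.2 k) := fun k =>
      ha.comp ((hH.comp measurable_fst).prodMk ((measurable_pi_apply k).comp measurable_snd))
    refine MeasurableSet.inter ?_ ?_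
    · have hm' : Measurable fun w : (Ω × (ℕ → I)) × I => a (H w.1.1) w.2 :=
        ha.comp ((hH.comp measurable_fst.fst).prodMk measurable_snd)
      have hs : MeasurableSet
          {w : (Ω × (ℕ → I)) × I | ∃ k, a (H w.1.1) w.2 = a (H w.1.1) (w.1.2 k)} := by
        have : {w : (Ω × (ℕ → I)) × I | ∃ k, a (H w.1.1) w.2 = a (H w.1.1) (w.1.2 k)} =
            ⋃ k, {w : (Ω × (ℕ → I)) × I | a (H w.1.1) w.2 = a (H w.1.1) (w.1.2 k)} := by
          ext; simp
        rw [this]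
        exact MeasurableSet.iUnion fun k => measurableSet_eq_fun hm'
          ((hm k).comp measurable_fst)
      exact (measurable_measure_prodMk_left (ν := (volume : Measure I)) hs.compl)
        (measurableSet_singleton 0)
    · refine measurableSet_setOfPred.2 ?_
      refine Measurable.forall fun i => Measurable.forall fun j => Measurable.forall fun k => ?_
      refine Measurable.imp (measurableSet_setOfPred.1 (measurableSet_lt (hm i) (hm j))) ?_
      refine Measurable.imp (measurableSet_setOfPred.1 (measurableSet_lt (hm j) (hm k))) ?_
      exact measurableSet_setOfPred.1 (measurableSet_le measurable_const ((hm k).sub (hm i)))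

end Core

/-! ### Least preferred actions and the geometry of their bins -/

section Quantizer

lemma abs_sub_sub_le_iff {u v m b : ℝ} (h : u < v) :
    |m - u - b| ≤ |m - v - b| ↔ m ≤ (u + v) / 2 + b := by
  rw [← sq_le_sq]
  constructor <;> intro <;> nlinarith

lemma abs_sub_sub_le_iff' {u v m b : ℝ} (h : u < v) :
    |m - v - b| ≤ |m - u - b| ↔ (u + v) / 2 + b ≤ m := by
  rw [← sq_le_sq]
  constructor <;> intro <;> nlinarith

/-- Of any three distinct values of `a`, the extreme ones have distance at least `δ`. -/
def IsSeparated (a : ℕ → ℝ) (δ : ℝ) : Prop :=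
  ∀ i j k, a i < a j → a j < a k → δ ≤ a k - a i

/-- Among the actions `a`, an encoder with source value `m` and bias `b` prefers `a k`. -/
def IsPreferred (a : ℕ → ℝ) (b m : ℝ) (k : ℕ) : Prop :=
  ∀ j, |m - a k - b| ≤ |m - a j - b|

/-- An open interval of length `δ` holds at most two values, since three would span less than `δ`;
compactness does the rest. -/
lemma IsSeparated.finite_range_inter {a : ℕ → ℝ} {δ : ℝ} (hδ : 0 < δ) (h : IsSeparated a δ)
    {K : Set ℝ} (hK : IsCompact K) : (range a ∩ K).Finite := by
  refine hK.induction_on (p := fun s => (range a ∩ s).Finite) (by simp)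
    (fun s t hst ht => ht.subset (inter_subset_inter_right _ hst))
    (fun s t hs ht => by rw [inter_union_distrib_left]; exact hs.union ht) fun x _ => ?_
  refine ⟨Ioo (x - δ / 2) (x + δ / 2),
    mem_nhdsWithin_of_mem_nhds (Ioo_mem_nhds (by linarith) (by linarith)), ?_⟩
  by_contra hinf
  obtain ⟨t, hts, ht⟩ := Set.Infinite.exists_subset_card_eq hinf 3
  set e := t.orderEmbOfFin ht
  have he : ∀ i, e i ∈ range a ∩ Ioo (x - δ / 2) (x + δ / 2) := fun i =>
    hts (t.orderEmbOfFin_mem ht i)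
  obtain ⟨⟨i, hi⟩, hi'⟩ := he 0
  obtain ⟨⟨j, hj⟩, -⟩ := he 1
  obtain ⟨⟨k, hk⟩, hk'⟩ := he 2
  have h1 : e 0 < e 1 := e.strictMono (by decide)
  have h2 : e 1 < e 2 := e.strictMono (by decide)
  rw [← hi, ← hj] at h1
  rw [← hj, ← hk] at h2
  have := h i j k h1 h2
  rw [hi, hk] at this
  linarith [hi'.1, hk'.2]

/-- Only finitely many action values are at least as good as `a 0`, so the best of them exists. -/
lemma IsSeparated.exists_isPreferred {a : ℕ → ℝ} {δ : ℝ} (hδ : 0 < δ) (h : IsSeparated a δ)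
    (b m : ℝ) : ∃ k, IsPreferred a b m k := by
  have hfin := h.finite_range_inter hδ (isCompact_closedBall (m - b) |m - a 0 - b|)
  have hdist : ∀ u, dist u (m - b) = |m - u - b| := fun u => by
    rw [Real.dist_eq, abs_sub_comm]; congr 1; ring
  have hne : (range a ∩ Metric.closedBall (m - b) |m - a 0 - b|).Nonempty :=
    ⟨a 0, ⟨0, rfl⟩, by rw [Metric.mem_closedBall, hdist]⟩
  obtain ⟨_, ⟨⟨k, rfl⟩, hk⟩, hmin⟩ := hfin.exists_minimalFor (fun u => |m - u - b|) _ hne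
  rw [Metric.mem_closedBall, hdist] at hk
  refine ⟨k, fun j => ?_⟩
  by_cases hj : |m - a j - b| ≤ |m - a 0 - b|
  · by_contra! hlt
    exact hlt.not_ge (hmin ⟨⟨j, rfl⟩, by rwa [Metric.mem_closedBall, hdist]⟩ hlt.le)
  · exact hk.trans (not_le.1 hj).le

/-- `K` selects, for each source value, the least index of a preferred action. -/
def IsLeastPreferred (a : ℕ → ℝ) (b : ℝ) (K : ℝ → ℕ) : Prop :=
  ∀ m, IsPreferred a b m (K m) ∧ ∀ j, IsPreferred a b m j → K m ≤ j

variable {a : ℕ → ℝ} {b : ℝ} {K : ℝ → ℕ}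

lemma IsPreferred.of_eq {m : ℝ} {j k : ℕ} (h : IsPreferred a b m k) (hjk : a j = a k) :
    IsPreferred a b m j := by
  intro i
  rw [hjk]
  exact h i

lemma IsLeastPreferred.le_of_eq (hK : IsLeastPreferred a b K) {m : ℝ} {j : ℕ}
    (h : a j = a (K m)) : K m ≤ j :=
  (hK m).2 j ((hK m).1.of_eq h)

lemma IsLeastPreferred.eq_of_eq (hK : IsLeastPreferred a b K) {m m' : ℝ}
    (h : a (K m) = a (K m')) : K m = K m' :=
  le_antisymm (hK.le_of_eq h.symm) (hK.le_of_eq h)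

/-- At the source value `a k + b` the action `a k` costs nothing, and no other action does. Hence
every listed action is induced by the selection. -/
lemma IsLeastPreferred.action_eq (hK : IsLeastPreferred a b K) (k : ℕ) :
    a (K (a k + b)) = a k := by
  have h := (hK (a k + b)).1 k
  have h0 : a k + b - a k - b = 0 := by ring
  rw [h0, abs_zero] at h
  have := abs_nonpos_iff.1 h
  linarith

lemma IsLeastPreferred.abs_eq (hK : IsLeastPreferred a b K) {m : ℝ} {k : ℕ}
    (hk : IsPreferred a b m k) : |m - a (K m) - b| = |m - a k - b| :=
  le_antisymm ((hK m).1 k) (hk _)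

lemma eq_midpoint_of_isPreferred {m : ℝ} {j k : ℕ} (hj : IsPreferred a b m j)
    (hk : IsPreferred a b m k) (hjk : a j ≠ a k) : m = (a j + a k) / 2 + b := by
  rcases lt_or_gt_of_ne hjk with h | h
  · exact le_antisymm ((abs_sub_sub_le_iff h).1 (hj k)) ((abs_sub_sub_le_iff' h).1 (hk j))
  · rw [add_comm (a j)]
    exact le_antisymm ((abs_sub_sub_le_iff h).1 (hk j)) ((abs_sub_sub_le_iff' h).1 (hj k))

variable {X : Type*} {φ : ℕ → X} {γ : X → ℝ}

/-- The least index depends only on the selected action, so a nonempty bin belongs to a single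
action. Another action selected strictly between two points of the bin would contradict the midpoint
inequality at the endpoint on its side. -/
lemma IsLeastPreferred.isQuantizer (hK : IsLeastPreferred (fun k => γ (φ k)) b K) :
    IsQuantizer fun m => φ (K m) := by
  refine ⟨(countable_range φ).mono (by rintro _ ⟨m, rfl⟩; exact ⟨K m, rfl⟩), fun x => ?_⟩
  refine OrdConnected.convex ⟨fun m₁ h₁ m₃ h₃ m₂ h₂ => ?_⟩
  have h₁ : φ (K m₁) = x := h₁
  have h₃ : φ (K m₃) = x := h₃
  have h13 : K m₃ = K m₁ := hK.eq_of_eq (by simp only [h₁, h₃])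
  suffices K m₂ = K m₁ by
    change φ (K m₂) = x
    rw [this, h₁]
  rcases h₂.1.eq_or_lt with rfl | h12
  · rfl
  rcases h₂.2.eq_or_lt with rfl | h23
  · exact h13
  refine hK.eq_of_eq ?_
  by_contra hne
  have p₁ := (hK m₁).1 (K m₂)
  have p₃ := (hK m₃).1 (K m₂)
  have p₂ := (hK m₂).1 (K m₁)
  rw [h13] at p₃
  rcases lt_or_gt_of_ne hne with h | h
  · linarith [(abs_sub_sub_le_iff' (b := b) h).1 p₁, (abs_sub_sub_le_iff (b := b) h).1 p₂]
  · linarith [(abs_sub_sub_le_iff (b := b) h).1 p₃, (abs_sub_sub_le_iff' (b := b) h).1 p₂]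

/-- A tie puts `m` at the shifted midpoint of the two actions, and the whole bin lies on one side of
that midpoint. -/
lemma IsLeastPreferred.mem_frontier (hK : IsLeastPreferred (fun k => γ (φ k)) b K) {m : ℝ} {k : ℕ}
    (hk : IsPreferred (fun k => γ (φ k)) b m k) (hne : γ (φ k) ≠ γ (φ (K m))) :
    m ∈ frontier ((fun m => φ (K m)) ⁻¹' {φ (K m)}) := by
  refine ⟨subset_closure rfl, fun hint => ?_⟩
  have hmid := eq_midpoint_of_isPreferred hk (hK m).1 hne
  have hsub : ∀ m' ∈ (fun m => φ (K m)) ⁻¹' {φ (K m)},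
      |m' - γ (φ (K m)) - b| ≤ |m' - γ (φ k) - b| := by
    intro m' hm'
    have hm' : φ (K m') = φ (K m) := hm'
    rw [← hm']
    exact (hK m').1 k
  rcases lt_or_gt_of_ne hne with h | h
  · have := interior_mono (t := Ici m) (fun m' hm' => by
      have := (abs_sub_sub_le_iff' h).1 (hsub m' hm')
      exact hmid.trans_le this) hint
    rw [interior_Ici] at this
    exact lt_irrefl m this
  · have := interior_mono (t := Iic m) (fun m' hm' => by
      have := (abs_sub_sub_le_iff h).1 (hsub m' hm')
      rw [add_comm (γ (φ (K m)))] at this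
      exact this.trans_eq hmid.symm) hint
    rw [interior_Iic] at this
    exact lt_irrefl m this

end Quantizer

/-! ### Measurable dependence on the common information -/

section Measurability

variable {𝓗 : Type*} [MeasurableSpace 𝓗] {X : Type*} [MeasurableSpace X]
  {γ : 𝓗 → X → ℝ} {φ : ℕ → 𝓗 → X}

lemma measurable_induced_action (hγ : Measurable (Function.uncurry γ))
    (hφ : ∀ k, Measurable (φ k)) (k : ℕ) : Measurable fun h => γ h (φ k h) :=
  hγ.comp (measurable_id.prodMk (hφ k))

/-- The least preferred index can be chosen measurably. -/
lemma exists_measurable_leastPreferred (hγ : Measurable (Function.uncurry γ))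
    (hφ : ∀ k, Measurable (φ k)) (b : ℝ) {δ : ℝ} (hδ : 0 < δ) :
    ∃ K : 𝓗 → ℝ → ℕ, Measurable (Function.uncurry K) ∧
      (∀ h, IsSeparated (fun k => γ h (φ k h)) δ →
        IsLeastPreferred (fun k => γ h (φ k h)) b (K h)) ∧
      ∀ h, ¬ IsSeparated (fun k => γ h (φ k h)) δ → ∀ m, K h m = 0 := by
  classical
  have ha := measurable_induced_action hγ hφ
  -- Where separation fails, every index is admitted, so the search is total and returns `0`.
  set p : 𝓗 × ℝ → ℕ → Prop := fun z k => IsSeparated (fun k => γ z.1 (φ k z.1)) δ →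
    IsPreferred (fun k => γ z.1 (φ k z.1)) b z.2 k with hp_def
  have hp : ∀ z, ∃ k, p z k := by
    intro z
    by_cases hz : IsSeparated (fun k => γ z.1 (φ k z.1)) δ
    · obtain ⟨k, hk⟩ := hz.exists_isPreferred hδ b z.2
      exact ⟨k, fun _ => hk⟩
    · exact ⟨0, fun h => absurd h hz⟩
  have ha' : ∀ k, Measurable fun z : 𝓗 × ℝ => γ z.1 (φ k z.1) := fun k =>
    (ha k).comp measurable_fst
  have hd : ∀ k, Measurable fun z : 𝓗 × ℝ => |z.2 - γ z.1 (φ k z.1) - b| := fun k =>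
    continuous_abs.measurable.comp ((measurable_snd.sub (ha' k)).sub_const b)
  have hpm : ∀ k, MeasurableSet {z | p z k} := by
    intro k
    refine measurableSet_setOfPred.2 (Measurable.imp ?_ ?_)
    · refine Measurable.forall fun i => Measurable.forall fun j => Measurable.forall fun l => ?_
      refine Measurable.imp (measurableSet_setOfPred.1 (measurableSet_lt (ha' i) (ha' j))) ?_
      refine Measurable.imp (measurableSet_setOfPred.1 (measurableSet_lt (ha' j) (ha' l))) ?_
      exact measurableSet_setOfPred.1 (measurableSet_le measurable_const ((ha' l).sub (ha' i)))
    · refine Measurable.forall fun j => ?_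
      exact measurableSet_setOfPred.1 (measurableSet_le (hd k) (hd j))
  refine ⟨fun h m => Nat.find (hp (h, m)), measurable_find hp hpm, fun h hh m => ⟨?_, ?_⟩,
    fun h hh m => ?_⟩
  · exact Nat.find_spec (hp (h, m)) hh
  · exact fun j hj => Nat.find_min' (hp (h, m)) fun _ => hj
  · exact (Nat.find_eq_zero _).2 fun h' => absurd h' hh

lemma measurable_selected_message (hφ : ∀ k, Measurable (φ k)) {K : 𝓗 → ℝ → ℕ}
    (hK : Measurable (Function.uncurry K)) :
    Measurable (Function.uncurry fun h m => φ (K h m) h) := by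
  have h1 : Measurable fun z : ℕ × 𝓗 => φ z.1 z.2 := measurable_from_prod_countable_right hφ
  exact h1.comp (hK.prodMk measurable_fst)

/-- The message sent by a least preferred selection is a measurable function of the common
information and of the induced action. -/
lemma exists_message_of_action (hγ : Measurable (Function.uncurry γ))
    (hφ : ∀ k, Measurable (φ k)) :
    ∃ ψ : 𝓗 × ℝ → X, Measurable ψ ∧ ∀ (b : ℝ) (h : 𝓗) (K : ℝ → ℕ),
      IsLeastPreferred (fun k => γ h (φ k h)) b K →
        ∀ m, ψ (h, γ h (φ (K m) h)) = φ (K m) h := by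
  classical
  have ha' : ∀ k, Measurable fun z : 𝓗 × ℝ => γ z.1 (φ k z.1) := fun k =>
    (measurable_induced_action hγ hφ k).comp measurable_fst
  -- The second alternative makes the search total at values that are not actions.
  have hex : ∀ z : 𝓗 × ℝ, ∃ k, γ z.1 (φ k z.1) = z.2 ∨ ∀ j, γ z.1 (φ j z.1) ≠ z.2 := by
    intro z
    by_cases h : ∃ k, γ z.1 (φ k z.1) = z.2
    · exact h.imp fun k hk => Or.inl hk
    · exact ⟨0, Or.inr (not_exists.1 h)⟩
  have hm : ∀ k, MeasurableSet
      {z : 𝓗 × ℝ | γ z.1 (φ k z.1) = z.2 ∨ ∀ j, γ z.1 (φ j z.1) ≠ z.2} := by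
    have h1 : ∀ k, Measurable fun z : 𝓗 × ℝ => γ z.1 (φ k z.1) = z.2 := fun k =>
      measurableSet_setOfPred.1 (measurableSet_eq_fun (ha' k) measurable_snd)
    exact fun k => measurableSet_setOfPred.2 ((h1 k).or (Measurable.forall fun j => (h1 j).not))
  refine ⟨fun z => φ (Nat.find (hex z)) z.1,
    Measurable.find (fun k => (hφ k).comp measurable_fst) hm hex, fun b h K hK m => ?_⟩
  have : Nat.find (hex (h, γ h (φ (K m) h))) = K m := by
    rw [Nat.find_eq_iff]
    refine ⟨Or.inl rfl, fun j hj hor => ?_⟩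
    rcases hor with h' | h'
    · exact hj.not_ge (hK.le_of_eq h')
    · exact h' (K m) rfl
  change φ (Nat.find (hex (h, γ h (φ (K m) h)))) h = _
  rw [this]

end Measurability

/-! ### Deviations at a single stage, measurability and independence -/

section Game

variable {X : Type*} {n : ℕ}

lemma history_update (γe : EncPolicy X) (g : EncInfo X n → X) (m : ℕ → ℝ) :
    ∀ k ≤ n, history (Function.update γe n g) m k = history γe m k
  | 0, _ => rfl
  | k + 1, hk => by
    rw [history, history, history_update γe g m k (by omega),
      Function.update_of_ne (by omega)]

lemma encInfo_update (γe : EncPolicy X) (g : EncInfo X n → X) (m : ℕ → ℝ) :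
    encInfo (Function.update γe n g) m n = encInfo γe m n := by
  rw [encInfo, encInfo, history_update γe g m n le_rfl]

lemma decInfo_eq (γe : EncPolicy X) (m : ℕ → ℝ) :
    decInfo γe m n = Fin.snoc (α := fun _ => X) (history γe m n) (γe n (encInfo γe m n)) := rfl

lemma decInfo_update (γe : EncPolicy X) (g : EncInfo X n → X) (m : ℕ → ℝ) :
    decInfo (Function.update γe n g) m n =
      Fin.snoc (α := fun _ => X) (history γe m n) (g (encInfo γe m n)) := by
  rw [decInfo_eq, encInfo_update, history_update γe g m n le_rfl, Function.update_self]

lemma action_update (γe : EncPolicy X) (γd : DecPolicy X) (g : EncInfo X n → X) (m : ℕ → ℝ) :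
    action (Function.update γe n g) γd m n =
      γd n (Fin.snoc (α := fun _ => X) (history γe m n) (g (encInfo γe m n))) := by
  rw [action, decInfo_update]

lemma encCost_update (b : ℝ) (γe : EncPolicy X) (γd : DecPolicy X) (g : EncInfo X n → X)
    (m : ℕ → ℝ) :
    encCost b (Function.update γe n g) γd m n = ENNReal.ofReal
      ((m n - γd n (Fin.snoc (α := fun _ => X) (history γe m n) (g (encInfo γe m n))) - b) ^ 2) := by
  rw [encCost, action_update]

lemma decCost_update (γe : EncPolicy X) (γd : DecPolicy X) (d : DecInfo X n → ℝ) (m : ℕ → ℝ) :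
    decCost γe (Function.update γd n d) m n =
      ENNReal.ofReal ((m n - d (decInfo γe m n)) ^ 2) := by
  rw [decCost, action, Function.update_self]

variable [MeasurableSpace X]

lemma measurable_snoc {k : ℕ} :
    Measurable fun z : (Fin k → X) × X => (Fin.snoc (α := fun _ => X) z.1 z.2 : Fin (k + 1) → X) := by
  rw [measurable_pi_iff]
  intro i
  refine Fin.lastCases ?_ (fun j => ?_) i
  · simpa using measurable_snd
  · simpa using! (measurable_pi_apply j).comp measurable_fst

/-- The messages sent before stage `k` depend measurably on the source values before stage `k`. -/
lemma exists_measurable_history (γe : EncPolicy X) :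
    ∀ k : ℕ, (∀ j < k, Measurable (γe j)) → ∃ F : (Fin k → ℝ) → Fin k → X, Measurable F ∧
      ∀ m : ℕ → ℝ, history γe m k = F fun i => m i
  | 0, _ => ⟨fun _ => Fin.elim0, measurable_const, fun _ => rfl⟩
  | k + 1, hγe => by
    obtain ⟨F, hF, hFm⟩ := exists_measurable_history γe k fun j hj => hγe j (by omega)
    have hinit : Measurable fun v : Fin (k + 1) → ℝ => F fun i => v i.castSucc :=
      hF.comp (measurable_pi_lambda _ fun i => measurable_pi_apply _)
    refine ⟨fun v => Fin.snoc (α := fun _ => X) (F fun i => v i.castSucc)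
      (γe k (v, F fun i => v i.castSucc)), ?_, fun m => ?_⟩
    · exact measurable_snoc.comp
        (hinit.prodMk ((hγe k (by omega)).comp (measurable_id.prodMk hinit)))
    · rw [history, hFm]
      rfl

variable {Ω : Type*} [MeasurableSpace Ω] {P : Measure Ω}

/-- If changing `f` to `f'` on `S` only does not lower a finite integral, then the integral over
`S` is not lowered. -/
lemma setLIntegral_le_of_lintegral_le {f f' f'' : Ω → ENNReal} {S : Set Ω} (hS : MeasurableSet S)
    (hfin : ∫⁻ ω, f ω ∂P ≠ ⊤) (h1 : ∀ ω ∈ S, f'' ω = f' ω) (h2 : ∀ ω ∈ Sᶜ, f'' ω = f ω)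
    (hle : ∫⁻ ω, f ω ∂P ≤ ∫⁻ ω, f'' ω ∂P) : ∫⁻ ω in S, f ω ∂P ≤ ∫⁻ ω in S, f' ω ∂P := by
  rw [← lintegral_add_compl f hS, ← lintegral_add_compl f'' hS, setLIntegral_congr_fun hS h1,
    setLIntegral_congr_fun hS.compl h2] at hle
  refine (ENNReal.add_le_add_iff_right ?_).1 hle
  exact ((setLIntegral_le_lintegral _ _).trans_lt hfin.lt_top).ne

lemma measurable_history {M : ℕ → Ω → ℝ} {γe : EncPolicy X} {k : ℕ}
    (hM : ∀ j < k, Measurable (M j)) (hγe : ∀ j < k, Measurable (γe j)) :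
    Measurable fun ω => history γe (fun k => M k ω) k := by
  obtain ⟨F, hF, hFm⟩ := exists_measurable_history γe k hγe
  simp only [hFm]
  exact hF.comp (measurable_pi_lambda _ fun i => hM i i.2)

lemma measurable_encInfo {M : ℕ → Ω → ℝ} {γe : EncPolicy X} {k : ℕ}
    (hM : ∀ j ≤ k, Measurable (M j)) (hγe : ∀ j < k, Measurable (γe j)) :
    Measurable fun ω => encInfo γe (fun k => M k ω) k :=
  Measurable.prodMk (measurable_pi_lambda _ fun i => hM i (Nat.lt_succ_iff.1 i.2))
    (measurable_history (fun j hj => hM j hj.le) hγe)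

/-- A Nash equilibrium of the final stage with finite encoder cost is perfect Bayesian. -/
lemma IsStageNash.isStagePerfectBayesian [IsProbabilityMeasure P] {M : ℕ → Ω → ℝ} {b : ℝ}
    {γe : EncPolicy X} {γd : DecPolicy X} (hM : ∀ k ≤ n, Measurable (M k))
    (hγe : ∀ k ≤ n, Measurable (γe k)) (hγd : ∀ k ≤ n, Measurable (γd k))
    (h : IsStageNash P M b n γe γd)
    (hfin : ∫⁻ ω, encCost b γe γd (fun k => M k ω) n ∂P ≠ ⊤) :
    IsStagePerfectBayesian P M b n γe γd := by
  classical
  have hInfo : Measurable fun ω => encInfo γe (fun k => M k ω) n :=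
    measurable_encInfo hM fun j hj => hγe j hj.le
  have hDec : Measurable fun ω => decInfo γe (fun k => M k ω) n :=
    measurable_history (fun j hj => hM j (by omega)) fun j hj => hγe j (by omega)
  refine ⟨fun g hg E hE => ?_, fun d hd D hD => ?_⟩
  -- The deviation is pasted with the given policy off `E`; finiteness of the cost lets the common
  -- part cancel.
  · refine setLIntegral_le_of_lintegral_le (hE.preimage hInfo) hfin ?_ ?_
      (h.1 (E.piecewise g (γe n)) (hg.piecewise hE (hγe n le_rfl)))
    · intro ω hω
      have hω : encInfo γe (fun k => M k ω) n ∈ E := hω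
      rw [encCost_update, encCost_update, piecewise_eq_of_mem _ _ _ hω]
    · intro ω hω
      have hω : encInfo γe (fun k => M k ω) n ∉ E := hω
      rw [encCost_update, piecewise_eq_of_notMem _ _ _ hω]
      rfl
  · have hfin' : ∫⁻ ω, decCost γe γd (fun k => M k ω) n ∂P ≠ ⊤ := by
      -- With `x = m - u`, the difference `2 (x - b)² + 2 b² - x²` is the square `(x - 2b)²`.
      have hle : ∀ ω, decCost γe γd (fun k => M k ω) n ≤
          2 * encCost b γe γd (fun k => M k ω) n + ENNReal.ofReal (2 * b ^ 2) := by
        intro ω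
        have h2 : (2 : ENNReal) = ENNReal.ofReal 2 := by simp
        rw [decCost, encCost, h2, ← ENNReal.ofReal_mul (by norm_num),
          ← ENNReal.ofReal_add (by positivity) (by positivity)]
        refine ENNReal.ofReal_le_ofReal ?_
        nlinarith [sq_nonneg (M n ω - action γe γd (fun k => M k ω) n - 2 * b)]
      refine ((lintegral_mono hle).trans_lt ?_).ne
      rw [lintegral_add_right _ measurable_const, lintegral_const_mul' _ _ (by simp)]
      simp only [lintegral_const, measure_univ, mul_one]
      exact ENNReal.add_lt_top.2 ⟨ENNReal.mul_lt_top (by simp) hfin.lt_top, ENNReal.ofReal_lt_top⟩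
    refine setLIntegral_le_of_lintegral_le (hD.preimage hDec) hfin' ?_ ?_
      (h.2 (D.piecewise d (γd n)) (hd.piecewise hD (hγd n le_rfl)))
    · intro ω hω
      have hω : decInfo γe (fun k => M k ω) n ∈ D := hω
      rw [decCost_update, decCost_update, piecewise_eq_of_mem _ _ _ hω]
    · intro ω hω
      have hω : decInfo γe (fun k => M k ω) n ∉ D := hω
      rw [decCost_update, piecewise_eq_of_notMem _ _ _ hω]
      rfl

/-- At a perfect Bayesian equilibrium no measurable deviation of the encoder gives a smaller cost
with positive probability. -/
lemma IsStagePerfectBayesian.ae_encCost_le [IsProbabilityMeasure P] {M : ℕ → Ω → ℝ} {b : ℝ}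
    {γe : EncPolicy X} {γd : DecPolicy X} (hM : ∀ k ≤ n, Measurable (M k))
    (hγe : ∀ k ≤ n, Measurable (γe k)) (hγd : ∀ k ≤ n, Measurable (γd k))
    (h : IsStagePerfectBayesian P M b n γe γd) {g : EncInfo X n → X} (hg : Measurable g) :
    ∀ᵐ ω ∂P, encCost b γe γd (fun k => M k ω) n ≤
      encCost b (Function.update γe n g) γd (fun k => M k ω) n := by
  have hInfo : Measurable fun ω => encInfo γe (fun k => M k ω) n :=
    measurable_encInfo hM fun j hj => hγe j hj.le
  set c : (EncInfo X n → X) → EncInfo X n → ENNReal := fun g i => ENNReal.ofReal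
    ((i.1 (Fin.last n) - γd n (Fin.snoc (α := fun _ => X) i.2 (g i)) - b) ^ 2) with hc
  have hcm : ∀ g, Measurable g → Measurable (c g) := fun g hg => by
    have h1 : Measurable fun i : EncInfo X n => γd n (Fin.snoc (α := fun _ => X) i.2 (g i)) :=
      (hγd n le_rfl).comp (measurable_snoc.comp (measurable_snd.prodMk hg))
    have h2 : Measurable fun i : EncInfo X n => i.1 (Fin.last n) :=
      (measurable_pi_apply _).comp measurable_fst
    exact (((h2.sub h1).sub_const b).pow_const 2).ennreal_ofReal
  -- Comparison of the integrals over all events in the encoder's information yields a pointwise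
  -- comparison for the law of that information.
  have hle : c (γe n) ≤ᵐ[P.map fun ω => encInfo γe (fun k => M k ω) n] c g := by
    have : IsProbabilityMeasure (P.map fun ω => encInfo γe (fun k => M k ω) n) :=
      Measure.isProbabilityMeasure_map hInfo.aemeasurable
    refine ae_le_of_forall_setLIntegral_le_of_sigmaFinite (hcm _ (hγe n le_rfl)) ?_
    intro E hE _
    rw [setLIntegral_map hE (hcm _ (hγe n le_rfl)) hInfo, setLIntegral_map hE (hcm _ hg) hInfo]
    have := h.1 g hg E hE
    simp only [encCost_update] at this
    exact this
  filter_upwards [ae_of_ae_map hInfo.aemeasurable hle] with ω hω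
  rw [encCost_update]
  exact hω

/-- The messages sent before stage `n` are independent of the source value of stage `n`. -/
lemma indepFun_history {M : ℕ → Ω → ℝ} {γe : EncPolicy X} (hM : ∀ k ≤ n, Measurable (M k))
    (hγe : ∀ k ≤ n, Measurable (γe k)) (hindep : iIndepFun (fun k : Fin (n + 1) => M k) P) :
    IndepFun (fun ω => history γe (fun k => M k ω) n) (M n) P := by
  classical
  obtain ⟨F, hF, hFm⟩ := exists_measurable_history γe n fun j hj => hγe j hj.le
  simp only [hFm]
  have h := hindep.indepFun_finset (Finset.univ.erase (Fin.last n)) {Fin.last n}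
    (by simp) (fun i => hM i (by omega))
  have hmem : ∀ i : Fin n, i.castSucc ∈ Finset.univ.erase (Fin.last n) := fun i => by
    simp [Fin.castSucc_ne_last]
  have h1 : Measurable fun v : Finset.univ.erase (Fin.last n) → ℝ =>
      F fun i => v ⟨i.castSucc, hmem i⟩ :=
    hF.comp (measurable_pi_lambda _ fun i => measurable_pi_apply _)
  have h2 : Measurable fun v : ({Fin.last n} : Finset (Fin (n + 1))) → ℝ =>
      v ⟨Fin.last n, by simp⟩ := measurable_pi_apply _
  exact h.comp h1 h2

/-- The joint law is a product, and for each `h` the excluded set is one point, which the law of `U`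
does not charge. -/
lemma ae_ne_of_indepFun {𝓗 : Type*} [MeasurableSpace 𝓗] [IsProbabilityMeasure P] {H : Ω → 𝓗}
    {U : Ω → ℝ} (hH : Measurable H) (hU : Measurable U) (hind : IndepFun H U P)
    (hatom : ∀ t : ℝ, P {ω | U ω = t} = 0) {g : 𝓗 → ℝ} (hg : Measurable g) :
    ∀ᵐ ω ∂P, U ω ≠ g (H ω) := by
  have hs : MeasurableSet {z : 𝓗 × ℝ | z.2 ≠ g z.1} :=
    (measurableSet_eq_fun measurable_snd (hg.comp measurable_fst)).compl
  have : ∀ᵐ z ∂(P.map fun ω => (H ω, U ω)), z.2 ≠ g z.1 := by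
    rw [(indepFun_iff_map_prod_eq_prod_map_map hH.aemeasurable hU.aemeasurable).1 hind,
      Measure.ae_prod_iff_ae_ae hs]
    refine Filter.Eventually.of_forall fun h => ?_
    refine (ae_map_iff (p := fun y => y ≠ g h) hU.aemeasurable
      (measurableSet_singleton (g h)).compl).2 ?_
    rw [ae_iff]
    simpa using hatom (g h)
  exact ae_of_ae_map (hH.prodMk hU).aemeasurable this

end Game

/-- If the actions of the equilibrium policy are those of another message `Y'`, which is a function
of the common information and the action, then the decoder remains optimal against `Y'`. -/
lemma decoder_optimal_of_message_of_action {Ω : Type*} [MeasurableSpace Ω] {P : Measure Ω}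
    {𝓗 : Type*} [MeasurableSpace 𝓗] {X : Type*} [MeasurableSpace X]
    {H : Ω → 𝓗} {Y Y' : Ω → X} {M : Ω → ℝ} {γ : 𝓗 → X → ℝ}
    (hγ : Measurable (Function.uncurry γ))
    (hdec : ∀ d : 𝓗 × X → ℝ, Measurable d → ∀ D : Set (𝓗 × X), MeasurableSet D →
      ∫⁻ ω in {ω | (H ω, Y ω) ∈ D}, ENNReal.ofReal ((M ω - γ (H ω) (Y ω)) ^ 2) ∂P ≤
        ∫⁻ ω in {ω | (H ω, Y ω) ∈ D}, ENNReal.ofReal ((M ω - d (H ω, Y ω)) ^ 2) ∂P)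
    (haction : ∀ᵐ ω ∂P, γ (H ω) (Y ω) = γ (H ω) (Y' ω)) {ψ : 𝓗 × ℝ → X} (hψ : Measurable ψ)
    (hmessage : ∀ᵐ ω ∂P, ψ (H ω, γ (H ω) (Y ω)) = Y' ω)
    {d : 𝓗 × X → ℝ} (hd : Measurable d) {D : Set (𝓗 × X)} (hD : MeasurableSet D) :
    ∫⁻ ω in {ω | (H ω, Y' ω) ∈ D}, ENNReal.ofReal ((M ω - γ (H ω) (Y' ω)) ^ 2) ∂P ≤
      ∫⁻ ω in {ω | (H ω, Y' ω) ∈ D}, ENNReal.ofReal ((M ω - d (H ω, Y' ω)) ^ 2) ∂P := by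
  -- `T` recodes the old message as the new one, so deviations and events for `Y'` pull back to
  -- deviations and events for `Y`.
  set T : 𝓗 × X → 𝓗 × X := fun z => (z.1, ψ (z.1, γ z.1 z.2)) with hT
  have hTm : Measurable T := measurable_fst.prodMk (hψ.comp (measurable_fst.prodMk hγ))
  have hset : ({ω | (H ω, Y' ω) ∈ D} : Set Ω) =ᵐ[P] {ω | (H ω, Y ω) ∈ T ⁻¹' D} := by
    rw [Filter.eventuallyEq_set]
    filter_upwards [hmessage] with ω hω
    change _ ∈ D ↔ (H ω, ψ (H ω, γ (H ω) (Y ω))) ∈ D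
    rw [hω]
  have h := hdec (d ∘ T) (hd.comp hTm) (T ⁻¹' D) (hD.preimage hTm)
  rw [setLIntegral_congr hset, setLIntegral_congr hset]
  refine (lintegral_congr_ae (ae_restrict_of_ae ?_)).trans_le
    (h.trans_eq (lintegral_congr_ae (ae_restrict_of_ae ?_)))
  · filter_upwards [haction] with ω hω
    rw [hω]
  · filter_upwards [hmessage] with ω hω
    simp only [Function.comp, hT, hω]

end CheapTalk

/-! ### The quantized policy and its comparison with the equilibrium -/

theorem mainTheorem1
    {Ω : Type*} [MeasurableSpace Ω] (P : Measure Ω) [IsProbabilityMeasure P]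
    {X : Type*} [MeasurableSpace X] [StandardBorelSpace X]
    (b : ℝ) (hb : b ≠ 0)
    -- the game has `n + 1` stages; the final one has index `n`
    (n : ℕ)
    (M : ℕ → Ω → ℝ) (hM : ∀ k ≤ n, Measurable (M k))
    (hindep : iIndepFun (fun k : Fin (n + 1) => M k) P)
    (hident : ∀ k ≤ n, IdentDistrib (M k) (M 0) P P)
    (γe : CheapTalk.EncPolicy X) (γd : CheapTalk.DecPolicy X)
    (hγe : ∀ k ≤ n, Measurable (γe k)) (hγd : ∀ k ≤ n, Measurable (γd k))
    (heq : CheapTalk.IsStagePerfectBayesian P M b n γe γd ∨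
      (CheapTalk.IsStageNash P M b n γe γd ∧
        ∫⁻ ω, CheapTalk.encCost b γe γd (fun k => M k ω) n ∂P ≠ ⊤)) :
    ∃ q : (Fin n → X) → ℝ → X,
      Measurable (Function.uncurry q) ∧
      (∀ h, CheapTalk.IsQuantizer (q h)) ∧
      -- against the same decoder, the quantized policy performs as well as the given one
      (∀ᵐ ω ∂P,
        CheapTalk.encCost b (Function.update γe n (CheapTalk.currentPolicy q)) γd
            (fun k => M k ω) n =
          CheapTalk.encCost b γe γd (fun k => M k ω) n) ∧
      -- the given policy induces only actions which the quantized policy induces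
      (∀ᵐ ω ∂P, ∃ t : ℝ,
        CheapTalk.action γe γd (fun k => M k ω) n =
          γd n (Fin.snoc (α := fun _ => X) (CheapTalk.history γe (fun k => M k ω) n)
            (q (CheapTalk.history γe (fun k => M k ω) n) t))) ∧
      -- both policies induce the same action, except possibly on the boundary of a bin
      (∀ᵐ ω ∂P,
        CheapTalk.action γe γd (fun k => M k ω) n =
            CheapTalk.action (Function.update γe n (CheapTalk.currentPolicy q)) γd
              (fun k => M k ω) n ∨
          M n ω ∈ frontier (q (CheapTalk.history γe (fun k => M k ω) n) ⁻¹'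
            {q (CheapTalk.history γe (fun k => M k ω) n) (M n ω)})) ∧
      -- for a source without atoms the quantized policy itself gives an equilibrium
      ((∀ t : ℝ, P {ω | M n ω = t} = 0) →
        (∀ᵐ ω ∂P,
          CheapTalk.action γe γd (fun k => M k ω) n =
            CheapTalk.action (Function.update γe n (CheapTalk.currentPolicy q)) γd
              (fun k => M k ω) n) ∧
        CheapTalk.IsStagePerfectBayesian P M b n
          (Function.update γe n (CheapTalk.currentPolicy q)) γd) := by
  classical
  have hpb : CheapTalk.IsStagePerfectBayesian P M b n γe γd :=
    heq.elim id fun h => h.1.isStagePerfectBayesian hM hγe hγd h.2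
  set H : Ω → Fin n → X := fun ω => CheapTalk.history γe (fun k => M k ω) n with hH_def
  set Y : Ω → X := fun ω => γe n (CheapTalk.encInfo γe (fun k => M k ω) n) with hY_def
  set γ : (Fin n → X) → X → ℝ := fun h x => γd n (Fin.snoc (α := fun _ => X) h x) with hγ_def
  have hH : Measurable H :=
    CheapTalk.measurable_history (fun j hj => hM j hj.le) fun j hj => hγe j hj.le
  have hInfo : Measurable fun ω => CheapTalk.encInfo γe (fun k => M k ω) n :=
    CheapTalk.measurable_encInfo hM fun j hj => hγe j hj.le
  have hY : Measurable Y := (hγe n le_rfl).comp hInfo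
  have hγ : Measurable (Function.uncurry γ) := (hγd n le_rfl).comp CheapTalk.measurable_snoc
  have habs : ∀ x y : ℝ, ENNReal.ofReal (x ^ 2) ≤ ENNReal.ofReal (y ^ 2) ↔ |x| ≤ |y| := fun x y => by
    rw [ENNReal.ofReal_le_ofReal_iff (sq_nonneg y), sq_le_sq]
  -- Deviations that ignore the source suffice, because `φ k` depends only on the common
  -- information.
  have henc : ∀ g : (Fin n → X) → X, Measurable g →
      ∀ᵐ ω ∂P, |M n ω - γ (H ω) (Y ω) - b| ≤ |M n ω - γ (H ω) (g (H ω)) - b| := by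
    intro g hg
    filter_upwards [hpb.ae_encCost_le hM hγe hγd (g := fun i => g i.2)
      (hg.comp measurable_snd)] with ω hω
    rw [CheapTalk.encCost_update] at hω
    exact (habs _ _).1 hω
  have hdec : ∀ d : (Fin n → X) × X → ℝ, Measurable d →
      ∀ D : Set ((Fin n → X) × X), MeasurableSet D →
      ∫⁻ ω in {ω | (H ω, Y ω) ∈ D}, ENNReal.ofReal ((M n ω - γ (H ω) (Y ω)) ^ 2) ∂P ≤
        ∫⁻ ω in {ω | (H ω, Y ω) ∈ D}, ENNReal.ofReal ((M n ω - d (H ω, Y ω)) ^ 2) ∂P := by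
    intro d hd D hD
    set S : (Fin (n + 1) → X) → (Fin n → X) × X := fun v => (fun i => v i.castSucc, v (Fin.last n))
      with hS_def
    have hS : Measurable S := Measurable.prodMk
      (measurable_pi_lambda _ fun i => measurable_pi_apply _) (measurable_pi_apply _)
    have hSY : ∀ ω, S (CheapTalk.decInfo γe (fun k => M k ω) n) = (H ω, Y ω) := fun ω => by
      rw [CheapTalk.decInfo_eq]
      simp [hS_def, hH_def, hY_def]
    have h := hpb.2 (d ∘ S) (hd.comp hS) (S ⁻¹' D) (hD.preimage hS)
    simp only [CheapTalk.decCost_update, mem_preimage, Function.comp, hSY] at h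
    exact h
  obtain ⟨φ, hφ, hφY, hφsep⟩ := CheapTalk.exists_messages hb hH hY (hM n le_rfl) hγ henc hdec
  have hδ : 0 < |b| / 3 := by have := abs_pos.2 hb; positivity
  obtain ⟨K, hKm, hK, hK0⟩ := CheapTalk.exists_measurable_leastPreferred hγ hφ b hδ
  have hKω : ∀ᵐ ω ∂P, CheapTalk.IsLeastPreferred (fun k => γ (H ω) (φ k (H ω))) b (K (H ω)) := by
    filter_upwards [hφsep] with ω hω using hK _ hω
  have hpref : ∀ᵐ ω ∂P, ∃ k, γ (H ω) (Y ω) = γ (H ω) (φ k (H ω)) ∧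
      CheapTalk.IsPreferred (fun k => γ (H ω) (φ k (H ω))) b (M n ω) k := by
    filter_upwards [hφY, ae_all_iff.2 fun k => henc (φ k) (hφ k)] with ω ⟨k, hk⟩ hω
    refine ⟨k, hk, fun j => ?_⟩
    rw [hk] at hω
    exact hω j
  set q : (Fin n → X) → ℝ → X := fun h m => φ (K h m) h with hq_def
  have hqm : Measurable (Function.uncurry q) := CheapTalk.measurable_selected_message hφ hKm
  have hq_action : ∀ ω, CheapTalk.action (Function.update γe n (CheapTalk.currentPolicy q)) γd
      (fun k => M k ω) n = γ (H ω) (q (H ω) (M n ω)) := fun ω => by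
    rw [CheapTalk.action_update]
    rfl
  have haction : ∀ ω, CheapTalk.action γe γd (fun k => M k ω) n = γ (H ω) (Y ω) := fun _ => rfl
  have hcost : ∀ᵐ ω ∂P,
      CheapTalk.encCost b (Function.update γe n (CheapTalk.currentPolicy q)) γd
        (fun k => M k ω) n = CheapTalk.encCost b γe γd (fun k => M k ω) n := by
    filter_upwards [hKω, hpref] with ω hω ⟨k, hk, hkp⟩
    rw [CheapTalk.encCost, CheapTalk.encCost, hq_action, haction, hk, ← sq_abs, hω.abs_eq hkp,
      sq_abs]
  refine ⟨q, hqm, fun h => ?_, hcost, ?_, ?_, fun hatom => ?_⟩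
  · by_cases hh : CheapTalk.IsSeparated (fun k => γ h (φ k h)) (|b| / 3)
    · exact (hK h hh).isQuantizer (φ := fun k => φ k h)
    -- On the null set of histories without separation the policy is constant, so the quantizer
    -- property holds for every `h`.
    · have hconst : q h = fun _ => φ 0 h := by
        funext m
        rw [hq_def]
        simp only [hK0 h hh m]
      rw [hconst]
      refine ⟨(countable_singleton (φ 0 h)).mono (range_subset_iff.2 fun _ => mem_singleton _),
        fun x => ?_⟩
      by_cases hx : φ 0 h = x
      · rw [preimage_const_of_mem (by exact hx)]
        exact convex_univ
      · rw [preimage_const_of_notMem (by exact hx)]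
        exact convex_empty
  · filter_upwards [hKω, hφY] with ω hω ⟨k, hk⟩
    -- This is the source value at which the action has zero encoder cost.
    refine ⟨γ (H ω) (φ k (H ω)) + b, ?_⟩
    rw [haction, hk]
    exact (hω.action_eq k).symm
  · filter_upwards [hKω, hpref] with ω hω ⟨k, hk, hkp⟩
    rw [haction, hq_action, hk]
    refine or_iff_not_imp_left.2 fun hne => ?_
    exact hω.mem_frontier (φ := fun k => φ k (H ω)) hkp hne
  · have heq_action : ∀ᵐ ω ∂P, γ (H ω) (Y ω) = γ (H ω) (q (H ω) (M n ω)) := by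
      have hind := CheapTalk.indepFun_history hM hγe hindep
      -- The shifted midpoints are countably many functions of the history, which is independent of
      -- `M n`.
      have hne : ∀ᵐ ω ∂P, ∀ j k,
          M n ω ≠ (γ (H ω) (φ j (H ω)) + γ (H ω) (φ k (H ω))) / 2 + b := by
        refine ae_all_iff.2 fun j => ae_all_iff.2 fun k => ?_
        exact CheapTalk.ae_ne_of_indepFun hH (hM n le_rfl) hind hatom
          (g := fun h => (γ h (φ j h) + γ h (φ k h)) / 2 + b)
          ((((CheapTalk.measurable_induced_action hγ hφ j).add
            (CheapTalk.measurable_induced_action hγ hφ k)).div_const 2).add_const b)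
      filter_upwards [hKω, hpref, hne] with ω hω ⟨k, hk, hkp⟩ hneω
      by_contra hcon
      rw [hk] at hcon
      exact hneω _ _ (CheapTalk.eq_midpoint_of_isPreferred hkp (hω (M n ω)).1 hcon)
    refine ⟨?_, fun g hg E hE => ?_, fun d hd D hD => ?_⟩
    · filter_upwards [heq_action] with ω hω
      rw [haction, hq_action, hω]
    · refine lintegral_mono_ae (ae_restrict_of_ae ?_)
      -- A deviation from the quantized policy costs the same as from the original one, and the two
      -- policies themselves cost the same almost surely.
      filter_upwards [hcost, hpb.ae_encCost_le hM hγe hγd hg] with ω h1 h2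
      rw [h1, Function.update_idem]
      exact h2
    · obtain ⟨ψ, hψ, hψK⟩ := CheapTalk.exists_message_of_action hγ hφ
      have hmessage : ∀ᵐ ω ∂P, ψ (H ω, γ (H ω) (Y ω)) = q (H ω) (M n ω) := by
        filter_upwards [hKω, heq_action] with ω hω hωa
        rw [hωa]
        exact hψK b _ _ hω _
      have hinfo : ∀ ω, CheapTalk.decInfo (Function.update γe n (CheapTalk.currentPolicy q))
          (fun k => M k ω) n = Fin.snoc (α := fun _ => X) (H ω) (q (H ω) (M n ω)) := fun ω => by
        rw [CheapTalk.decInfo_update]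
        rfl
      have h := CheapTalk.decoder_optimal_of_message_of_action hγ hdec heq_action hψ hmessage
        (hd.comp CheapTalk.measurable_snoc) (hD.preimage CheapTalk.measurable_snoc)
      simp only [CheapTalk.decCost_update]
      simp only [CheapTalk.decCost, hq_action, hinfo]
      exact h
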